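/- Let $1\le N\le 3$ and let $\Omega\subset\mathbb{R}^N$ be a bounded domain with smooth boundary; put $H=L^2(\Omega)$, with norm $\|\cdot\|$. Consider either homogeneous Dirichlet conditions, with $V=H^1_0(\Omega)$ and $B:V\to V'$, $\langle Bu,v\rangle=(\nabla u,\nabla v)$, or homogeneous Neumann conditions, with $V=H^1(\Omega)$ and $B:V\to V'$, $\langle Bu,v\rangle=(u,v)+(\nabla u,\nabla v)$; in both cases $H$ is identified with a subspace of $V'$. Assume: (a) $\alpha\in C^1(\mathbb{R})$, $\alpha(0)=0$, and $\alpha'(r)\ge\sigma>0$ for all $r\in\mathbb{R}$; (b) $I\subset\mathbb{R}$ is an open, bounded or unbounded, interval with $0\in I$, $\lambda\ge 0$, $W\in C^{1,1}_{\rm loc}(I)$, $W'(0)=0$, $W''\ge-\lambda$ a.e. in $I$, and $W'(r)\,\mathrm{sign}(r)\to+\infty$ as $r$ tends to either end (finite or infinite) of $I$; (c) $f\in L^\infty(\Omega)$. Let $\mathcal{X}_2=\{u\in V: Bu\in H,\ u\in I \text{ a.e. in }\Omega,\ W'(u)\in H\}$ and $$d_2^2(u,v)=\|u-v\|^2+\|Bu-Bv\|^2+\|(W'+\lambda)(u)-(W'+\lambda)(v)\|^2,$$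 where $(W'+\lambda)(u)=W'(u)+\lambda u$. Let $\mathcal{X}_\infty$ be the set of all $u\in\mathcal{X}_2$ with $u,Bu,W'(u)\in L^\infty(\Omega)$, and let $d_\infty$ be defined on it as $d_2$, with the norm of $L^\infty(\Omega)$ in place of that of $H$. For $u_0\in\mathcal{X}_2$, an $\mathcal{X}_2$-solution with initial datum $u_0$ is a function $u:[0,\infty)\to H$ with $u(0)=u_0$ such that $u,u_t,\alpha(u_t),Bu,W'(u)\in L^\infty(0,\infty;H)$ (with $u(t)=u(0)+\int_0^t u_t(\tau)\,d\tau$ for all $t\ge 0$), such that $$\alpha(u_t)+Bu+W'(u)=f\quad\text{in } H,\ \text{a.e. in }(0,\infty),$$ and such that, for some $C>0$, one has $u(t)\in\mathcal{X}_2$ and $d_2^2(u(t),0)\le C^2$ for all $t\in[0,\infty)$. **Corollary (Uniqueness).** Let $u,v$ be $\mathcal{X}_2$-solutions with initial data $u_0,v_0\in\mathcal{X}_2$, respectively. Assume that, for some $s,c\ge 0$, $u(s)=v(s)$, and that, for all $t\ge s$, $u(t),v(t)\in\mathcal{X}_\infty$ and $$d_\infty(u(t),0)+d_\infty(v(t),0)\le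 c,$$ with $c$ independent of $t$. Then $u(t)=v(t)$ for all $t\ge s$. -/

import Mathlib

open MeasureTheory Set Filter Topology
open scoped ENNReal NNReal ContDiff

noncomputable section

namespace DoublyNonlinear

/-- The two homogeneous boundary conditions. -/
inductive BoundaryCondition where
  | dirichlet : BoundaryCondition
  | neumann : BoundaryCondition

/-- The coefficient of the zero order term in the operator `B`. -/
def BoundaryCondition.massCoeff : BoundaryCondition → ℝ
  | .dirichlet => 0
  | .neumann => 1

/-- A bounded domain (nonempty, open, connected) of `ℝ^N` with smooth boundary: near each boundary
point, `Ω` is the sublevel set `{ρ < 0}` of a smooth function with nonvanishing differential. -/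
structure IsSmoothBoundedDomain {N : ℕ} (Ω : Set (EuclideanSpace ℝ (Fin N))) : Prop where
  isOpen : IsOpen Ω
  isConnected : IsConnected Ω
  isBounded : Bornology.IsBounded Ω
  smooth_boundary : ∀ x ∈ frontier Ω, ∃ U ∈ 𝓝 x, ∃ ρ : EuclideanSpace ℝ (Fin N) → ℝ,
    ContDiff ℝ ∞ ρ ∧ fderiv ℝ ρ x ≠ 0 ∧ Ω ∩ U = {y ∈ U | ρ y < 0}

/-- `H = L²(Ω)`. -/
abbrev L2 {N : ℕ} (Ω : Set (EuclideanSpace ℝ (Fin N))) : Type :=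
  Lp ℝ 2 (volume.restrict Ω)

/-- `L²(Ω; ℝ^N)`. -/
abbrev L2vec {N : ℕ} (Ω : Set (EuclideanSpace ℝ (Fin N))) : Type :=
  Lp (EuclideanSpace ℝ (Fin N)) 2 (volume.restrict Ω)

/-- Pairs `(u, g)` in `L²(Ω) × L²(Ω; ℝ^N)`, with the norm `(‖u‖² + ‖g‖²)^(1/2)`. -/
abbrev L2Pair {N : ℕ} (Ω : Set (EuclideanSpace ℝ (Fin N))) : Type :=
  WithLp 2 (L2 Ω × L2vec Ω)

/-- Test functions, `φ ∈ C_c^∞(Ω)`. -/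
structure IsTestFunction {N : ℕ} (Ω : Set (EuclideanSpace ℝ (Fin N)))
    (φ : EuclideanSpace ℝ (Fin N) → ℝ) : Prop where
  smooth : ContDiff ℝ ∞ φ
  hasCompactSupport : HasCompactSupport φ
  tsupport_subset : tsupport φ ⊆ Ω

namespace IsTestFunction

variable {N : ℕ} {Ω : Set (EuclideanSpace ℝ (Fin N))} {φ ψ : EuclideanSpace ℝ (Fin N) → ℝ}

theorem zero (Ω : Set (EuclideanSpace ℝ (Fin N))) : IsTestFunction Ω 0 where
  smooth := contDiff_const
  hasCompactSupport := HasCompactSupport.zero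
  tsupport_subset := by simp [tsupport, Function.support_zero]

theorem add (hφ : IsTestFunction Ω φ) (hψ : IsTestFunction Ω ψ) : IsTestFunction Ω (φ + ψ) where
  smooth := hφ.smooth.add hψ.smooth
  hasCompactSupport := hφ.hasCompactSupport.add hψ.hasCompactSupport
  tsupport_subset :=
    (tsupport_add φ ψ).trans (union_subset hφ.tsupport_subset hψ.tsupport_subset)

theorem const_smul (hφ : IsTestFunction Ω φ) (c : ℝ) : IsTestFunction Ω (c • φ) where
  smooth := hφ.smooth.const_smul c
  hasCompactSupport := hφ.hasCompactSupport.smul_left (f := fun _ => c)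
  tsupport_subset := (tsupport_smul_subset_right (fun _ => c) φ).trans hφ.tsupport_subset

theorem differentiable (hφ : IsTestFunction Ω φ) : Differentiable ℝ φ :=
  hφ.smooth.differentiable (by simp)

theorem memLp (hφ : IsTestFunction Ω φ) : MemLp φ 2 (volume.restrict Ω) :=
  hφ.smooth.continuous.memLp_of_hasCompactSupport hφ.hasCompactSupport

theorem memLp_fderiv (hφ : IsTestFunction Ω φ) (e : EuclideanSpace ℝ (Fin N)) :
    MemLp (fun x => fderiv ℝ φ x e) 2 (volume.restrict Ω) :=
  ((hφ.smooth.continuous_fderiv (by simp)).clm_apply continuous_const).memLp_of_hasCompactSupport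
    (hφ.hasCompactSupport.fderiv_apply (𝕜 := ℝ) e)

end IsTestFunction

/-- `g` is the weak (distributional) gradient of `u` in `Ω`. -/
def IsWeakGradient {N : ℕ} (Ω : Set (EuclideanSpace ℝ (Fin N))) (u : L2 Ω) (g : L2vec Ω) : Prop :=
  ∀ φ : EuclideanSpace ℝ (Fin N) → ℝ, IsTestFunction Ω φ → ∀ i : Fin N,
    ∫ x in Ω, u x * fderiv ℝ φ x (EuclideanSpace.single i 1) = -∫ x in Ω, g x i * φ x

theorem integrable_mul_fderiv {N : ℕ} {Ω : Set (EuclideanSpace ℝ (Fin N))} (u : L2 Ω)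
    {φ : EuclideanSpace ℝ (Fin N) → ℝ} (hφ : IsTestFunction Ω φ) (e : EuclideanSpace ℝ (Fin N)) :
    Integrable (fun x => u x * fderiv ℝ φ x e) (volume.restrict Ω) :=
  (Lp.memLp u).integrable_mul (hφ.memLp_fderiv e)

theorem integrable_coord_mul {N : ℕ} {Ω : Set (EuclideanSpace ℝ (Fin N))} (g : L2vec Ω)
    {φ : EuclideanSpace ℝ (Fin N) → ℝ} (hφ : IsTestFunction Ω φ) (i : Fin N) :
    Integrable (fun x => g x i * φ x) (volume.restrict Ω) :=
  MemLp.integrable_mul (p := 2) (q := 2)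
    ((EuclideanSpace.proj i : EuclideanSpace ℝ (Fin N) →L[ℝ] ℝ).comp_memLp' (Lp.memLp g)) hφ.memLp

/-- `H¹(Ω)`, each element being written as the pair of the function and its weak gradient
(which is unique); the inner product is that of `H¹(Ω)`. -/
def H1 {N : ℕ} (Ω : Set (EuclideanSpace ℝ (Fin N))) : Submodule ℝ (L2Pair Ω) where
  carrier := {p | IsWeakGradient Ω p.fst p.snd}
  zero_mem' := by
    intro φ hφ i
    have h1 : ∫ x in Ω, (0 : L2 Ω) x * fderiv ℝ φ x (EuclideanSpace.single i 1) = 0 := by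
      refine integral_eq_zero_of_ae ?_
      filter_upwards [Lp.coeFn_zero ℝ 2 (volume.restrict Ω)] with x hx
      rw [hx]
      simp
    have h2 : ∫ x in Ω, (0 : L2vec Ω) x i * φ x = 0 := by
      refine integral_eq_zero_of_ae ?_
      filter_upwards [Lp.coeFn_zero (EuclideanSpace ℝ (Fin N)) 2 (volume.restrict Ω)] with x hx
      rw [hx]
      simp
    change ∫ x in Ω, (0 : L2 Ω) x * _ = -∫ x in Ω, (0 : L2vec Ω) x i * φ x
    rw [h1, h2, neg_zero]
  add_mem' := by
    intro p q hp hq φ hφ i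
    have h1 : ∫ x in Ω, (p.fst + q.fst) x * fderiv ℝ φ x (EuclideanSpace.single i 1)
        = (∫ x in Ω, p.fst x * fderiv ℝ φ x (EuclideanSpace.single i 1))
          + ∫ x in Ω, q.fst x * fderiv ℝ φ x (EuclideanSpace.single i 1) := by
      rw [← integral_add (integrable_mul_fderiv _ hφ _) (integrable_mul_fderiv _ hφ _)]
      refine integral_congr_ae ?_
      filter_upwards [Lp.coeFn_add p.fst q.fst] with x hx
      rw [hx, Pi.add_apply, add_mul]
    have h2 : ∫ x in Ω, (p.snd + q.snd) x i * φ x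
        = (∫ x in Ω, p.snd x i * φ x) + ∫ x in Ω, q.snd x i * φ x := by
      rw [← integral_add (integrable_coord_mul _ hφ _) (integrable_coord_mul _ hφ _)]
      refine integral_congr_ae ?_
      filter_upwards [Lp.coeFn_add p.snd q.snd] with x hx
      rw [hx, Pi.add_apply, PiLp.add_apply, add_mul]
    change ∫ x in Ω, (p.fst + q.fst) x * _ = -∫ x in Ω, (p.snd + q.snd) x i * φ x
    rw [h1, h2, hp φ hφ i, hq φ hφ i, neg_add]
  smul_mem' := by
    intro c p hp φ hφ i
    have h1 : ∫ x in Ω, (c • p.fst) x * fderiv ℝ φ x (EuclideanSpace.single i 1)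
        = c * ∫ x in Ω, p.fst x * fderiv ℝ φ x (EuclideanSpace.single i 1) := by
      rw [← integral_const_mul]
      refine integral_congr_ae ?_
      filter_upwards [Lp.coeFn_smul c p.fst] with x hx
      simp [hx, mul_assoc]
    have h2 : ∫ x in Ω, (c • p.snd) x i * φ x = c * ∫ x in Ω, p.snd x i * φ x := by
      rw [← integral_const_mul]
      refine integral_congr_ae ?_
      filter_upwards [Lp.coeFn_smul c p.snd] with x hx
      simp [hx, mul_assoc]
    change ∫ x in Ω, (c • p.fst) x * _ = -∫ x in Ω, (c • p.snd) x i * φ x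
    rw [h1, h2, hp φ hφ i, mul_neg]

/-- The pairs `(φ, ∇φ)` with `φ ∈ C_c^∞(Ω)`. -/
def testPairs {N : ℕ} (Ω : Set (EuclideanSpace ℝ (Fin N))) : Submodule ℝ (L2Pair Ω) where
  carrier := {p | ∃ φ : EuclideanSpace ℝ (Fin N) → ℝ, IsTestFunction Ω φ ∧
    p.fst =ᵐ[volume.restrict Ω] φ ∧ p.snd =ᵐ[volume.restrict Ω] gradient φ}
  zero_mem' := by
    refine ⟨0, IsTestFunction.zero Ω, Lp.coeFn_zero ℝ 2 (volume.restrict Ω), ?_⟩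
    refine (Lp.coeFn_zero (EuclideanSpace ℝ (Fin N)) 2 (volume.restrict Ω)).trans ?_
    refine Eventually.of_forall fun x => ?_
    simp [gradient]
  add_mem' := by
    rintro p q ⟨φ, hφ, hp1, hp2⟩ ⟨ψ, hψ, hq1, hq2⟩
    refine ⟨φ + ψ, hφ.add hψ, (Lp.coeFn_add p.fst q.fst).trans (hp1.add hq1),
      (Lp.coeFn_add p.snd q.snd).trans ((hp2.add hq2).trans ?_)⟩
    refine Eventually.of_forall fun x => ?_
    simp [gradient, fderiv_add (hφ.differentiable x) (hψ.differentiable x)]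
  smul_mem' := by
    rintro c p ⟨φ, hφ, hp1, hp2⟩
    refine ⟨c • φ, hφ.const_smul c, (Lp.coeFn_smul c p.fst).trans (hp1.const_smul c),
      (Lp.coeFn_smul c p.snd).trans ((hp2.const_smul c).trans ?_)⟩
    refine Eventually.of_forall fun x => ?_
    simp [gradient, fderiv_const_smul (hφ.differentiable x) c]

/-- `H¹₀(Ω)`, the closure of `C_c^∞(Ω)` in the norm of `H¹(Ω)`. -/
def H10 {N : ℕ} (Ω : Set (EuclideanSpace ℝ (Fin N))) : Submodule ℝ (L2Pair Ω) :=
  (testPairs Ω).topologicalClosure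

/-- The space `V`: `H¹₀(Ω)` for Dirichlet and `H¹(Ω)` for Neumann conditions. -/
def V {N : ℕ} (bc : BoundaryCondition) (Ω : Set (EuclideanSpace ℝ (Fin N))) :
    Submodule ℝ (L2Pair Ω) :=
  match bc with
  | .dirichlet => H10 Ω
  | .neumann => H1 Ω

/-- The operator `B : V → V'`: `⟨B u, v⟩ = (∇u, ∇v)` for Dirichlet conditions and
`⟨B u, v⟩ = (u, v) + (∇u, ∇v)` for Neumann conditions. -/
def B {N : ℕ} (bc : BoundaryCondition) (Ω : Set (EuclideanSpace ℝ (Fin N))) :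
    V bc Ω →ₗ[ℝ] StrongDual ℝ (V bc Ω) where
  toFun p :=
    bc.massCoeff •
      (innerSL ℝ p.1.fst).comp (WithLp.fstL 2 ℝ (L2 Ω) (L2vec Ω) ∘L (V bc Ω).subtypeL)
    + (innerSL ℝ p.1.snd).comp (WithLp.sndL 2 ℝ (L2 Ω) (L2vec Ω) ∘L (V bc Ω).subtypeL)
  map_add' p q := by
    ext r
    simp
    ring
  map_smul' c p := by
    ext r
    simp
    ring

/-- `u ∈ V` and the functional `B u ∈ V'` is the element `h` of `H ⊂ V'`. -/
def IsB {N : ℕ} (bc : BoundaryCondition) (Ω : Set (EuclideanSpace ℝ (Fin N)))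
    (u h : L2 Ω) : Prop :=
  ∃ p : V bc Ω, p.1.fst = u ∧ ∀ q : V bc Ω, B bc Ω p q = inner ℝ h q.1.fst

open Classical in
/-- `B u` as an element of `H`, for `u ∈ V` with `B u ∈ H` (and `0` for all other `u`). -/
def BH {N : ℕ} (bc : BoundaryCondition) (Ω : Set (EuclideanSpace ℝ (Fin N))) (u : L2 Ω) : L2 Ω :=
  if h : ∃ b : L2 Ω, IsB bc Ω u b then h.choose else 0

open Classical in
/-- The superposition operator `u ↦ g(u)` in `H`, for `u` with `g(u) ∈ H` (and `0` for all
other `u`). -/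
def superpos {N : ℕ} (Ω : Set (EuclideanSpace ℝ (Fin N))) (g : ℝ → ℝ) (u : L2 Ω) : L2 Ω :=
  if h : MemLp (fun x => g (u x)) 2 (volume.restrict Ω) then h.toLp _ else 0

/-- The assumptions on `α`: `α ∈ C¹(ℝ)`, `α(0) = 0`, `α' ≥ σ > 0`. -/
structure HypAlpha (α : ℝ → ℝ) (σ : ℝ) : Prop where
  contDiff : ContDiff ℝ 1 α
  map_zero : α 0 = 0
  sigma_pos : 0 < σ
  le_deriv : ∀ r, σ ≤ deriv α r

/-- The assumptions on the potential `W` on the open interval `I ∋ 0`: `W ∈ C^{1,1}_loc(I)`,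
`W'(0) = 0`, `W'' ≥ -lam` a.e. in `I`, and `W'(r) sign r → +∞` as `r` tends to the boundary of `I`
(the ends `±∞` included), i.e. as `r` leaves every compact subset of `I`.
The values of `W` outside `I` are irrelevant. -/
structure HypW (I : Set ℝ) (W : ℝ → ℝ) (lam : ℝ) : Prop where
  isOpen : IsOpen I
  ordConnected : I.OrdConnected
  zero_mem : (0 : ℝ) ∈ I
  lam_nonneg : 0 ≤ lam
  contDiffOn : ContDiffOn ℝ 1 W I
  locallyLipschitzOn : LocallyLipschitzOn I (deriv W)
  deriv_zero : deriv W 0 = 0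
  second_deriv_ge : ∀ᵐ r ∂(volume.restrict I), -lam ≤ deriv (deriv W) r
  coercive : ∀ M : ℝ, ∃ K ⊆ I, IsCompact K ∧ ∀ r ∈ I \ K, M ≤ deriv W r * Real.sign r

/-- The phase space `X₂ = {u ∈ H : B u, W'(u) ∈ H}`. As `W` is defined on `I` only, `W'(u)` makes
sense if `u` takes its values in `I` a.e. -/
structure MemX2 {N : ℕ} (bc : BoundaryCondition) (Ω : Set (EuclideanSpace ℝ (Fin N)))
    (I : Set ℝ) (W : ℝ → ℝ) (u : L2 Ω) : Prop where
  exists_B : ∃ b : L2 Ω, IsB bc Ω u b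
  mem_I : ∀ᵐ x ∂(volume.restrict Ω), u x ∈ I
  memLp_W : MemLp (fun x => deriv W (u x)) 2 (volume.restrict Ω)

/-- The operator `(W' + lam)(u) = W'(u) + lam u`. -/
def WlamH {N : ℕ} (Ω : Set (EuclideanSpace ℝ (Fin N))) (W : ℝ → ℝ) (lam : ℝ) (u : L2 Ω) : L2 Ω :=
  superpos Ω (deriv W) u + lam • u

/-- The metric of `X₂`. -/
def d2 {N : ℕ} (bc : BoundaryCondition) (Ω : Set (EuclideanSpace ℝ (Fin N)))
    (W : ℝ → ℝ) (lam : ℝ) (u v : L2 Ω) : ℝ :=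
  √(‖u - v‖ ^ 2 + ‖BH bc Ω u - BH bc Ω v‖ ^ 2 + ‖WlamH Ω W lam u - WlamH Ω W lam v‖ ^ 2)

/-- The space `X_∞ = {u ∈ L^∞(Ω) : B u, W'(u) ∈ L^∞(Ω)}`, a subset of `X₂` as `Ω` is bounded. -/
structure MemXInf {N : ℕ} (bc : BoundaryCondition) (Ω : Set (EuclideanSpace ℝ (Fin N)))
    (I : Set ℝ) (W : ℝ → ℝ) (u : L2 Ω) : Prop where
  memX2 : MemX2 bc Ω I W u
  memLp_u : MemLp u ∞ (volume.restrict Ω)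
  memLp_B : MemLp (BH bc Ω u) ∞ (volume.restrict Ω)
  memLp_W : MemLp (superpos Ω (deriv W) u) ∞ (volume.restrict Ω)

/-- The norm of `L^∞(Ω)`, for an element of `L²(Ω)` that lies in `L^∞(Ω)`. -/
def normInf {N : ℕ} (Ω : Set (EuclideanSpace ℝ (Fin N))) (u : L2 Ω) : ℝ :=
  (eLpNorm u ∞ (volume.restrict Ω)).toReal

/-- The metric of `X_∞`. -/
def dInf {N : ℕ} (bc : BoundaryCondition) (Ω : Set (EuclideanSpace ℝ (Fin N)))
    (W : ℝ → ℝ) (lam : ℝ) (u v : L2 Ω) : ℝ :=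
  √(normInf Ω (u - v) ^ 2 + normInf Ω (BH bc Ω u - BH bc Ω v) ^ 2
    + normInf Ω (WlamH Ω W lam u - WlamH Ω W lam v) ^ 2)

/-- `u ∈ L^∞(0, ∞; H)`. -/
def MemLInfTime {N : ℕ} {Ω : Set (EuclideanSpace ℝ (Fin N))} (u : ℝ → L2 Ω) : Prop :=
  MemLp u ∞ (volume.restrict (Ioi (0 : ℝ)))

/-- `X₂`-solutions `u : [0, ∞) → H` with initial datum `u₀` (only the values `u t`, `t ≥ 0`,
matter). That `ut` is the time derivative of `u` is expressed by
`u(t) = u(0) + ∫₀ᵗ ut` for all `t ≥ 0`. -/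
structure IsX2Solution {N : ℕ} (bc : BoundaryCondition) (Ω : Set (EuclideanSpace ℝ (Fin N)))
    (α : ℝ → ℝ) (I : Set ℝ) (W : ℝ → ℝ) (lam : ℝ)
    (f : EuclideanSpace ℝ (Fin N) → ℝ) (u₀ : L2 Ω) (u : ℝ → L2 Ω) : Prop where
  initial : u 0 = u₀
  memX2 : ∀ t, 0 ≤ t → MemX2 bc Ω I W (u t)
  d2_bound : ∃ C : ℝ, 0 < C ∧ ∀ t, 0 ≤ t → d2 bc Ω W lam (u t) 0 ^ 2 ≤ C ^ 2
  memLInf_u : MemLInfTime u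
  memLInf_B : MemLInfTime fun t => BH bc Ω (u t)
  memLInf_W : MemLInfTime fun t => superpos Ω (deriv W) (u t)
  exists_ut : ∃ ut : ℝ → L2 Ω, MemLInfTime ut ∧
    (∀ t, 0 ≤ t → u t = u 0 + ∫ τ in (0 : ℝ)..t, ut τ) ∧
    (∀ᵐ t ∂(volume.restrict (Ioi (0 : ℝ))),
      MemLp (fun x => α (ut t x)) 2 (volume.restrict Ω)) ∧
    MemLInfTime (fun t => superpos Ω α (ut t)) ∧
    ∀ᵐ t ∂(volume.restrict (Ioi (0 : ℝ))),
      ⇑(superpos Ω α (ut t) + BH bc Ω (u t) + superpos Ω (deriv W) (u t))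
        =ᵐ[volume.restrict Ω] f

end DoublyNonlinear

end

/-! Put `w = u - v`. Subtracting the equations removes `f` and leaves `α(u_t) - α(v_t) + Bw =
-(W'(u) - W'(v))`. The bound in `X_∞` confines `W'(u)` and `W'(v)` to a fixed bounded range, so by
coercivity both functions take values in a compact subset of `I`, where `W'` is Lipschitz
(`HypW.exists_lipschitz`). Testing with `w_t` and using `α' ≥ σ` gives `(Bw, w_t) ≤ -σ‖w_t‖² +
L‖w‖‖w_t‖`. Hence the energy `(Bw, w) + ‖w‖²` has derivative at most a constant times itself; it
vanishes at `s`, so Gronwall gives `w = 0`.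

The delicate point is the chain rule `d/dt (Bw, w) = 2 (Bw, w_t)`, since `Bw` need not be
differentiable in `H`. Symmetry of `B` together with boundedness of `Bw` makes `(Bw, w)` Lipschitz
in time, and nonnegativity of `B` identifies its derivative wherever it exists
(`HasDerivAt.of_symm_nonneg`). The whole energy argument is isolated in
`eq_zero_of_energy_inequality`. -/

/-! ### Gronwall's inequality -/

/-- Gronwall's inequality for absolutely continuous functions with zero initial value. -/
theorem AbsolutelyContinuousOnInterval.nonpos_of_ae_deriv_le {y : ℝ → ℝ} {a b K : ℝ} (hab : a ≤ b)
    (hy : AbsolutelyContinuousOnInterval y a b) (ha : y a ≤ 0)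
    (h : ∀ᵐ x, x ∈ Ioo a b → deriv y x ≤ K * y x) : y b ≤ 0 := by
  -- Integrating factor: `exp(-Kx) y` has nonpositive derivative a.e., and absolute continuity turns
  -- this into a comparison of its endpoint values.
  have he : AbsolutelyContinuousOnInterval (fun x => Real.exp (-K * x)) a b :=
    ContDiffOn.absolutelyContinuousOnInterval (by fun_prop)
  have hg := he.fun_mul hy
  have hint := hg.integral_deriv_eq_sub
  have hle : 0 ≤ ∫ x in a..b, -deriv (fun x => Real.exp (-K * x) * y x) x := by
    refine intervalIntegral.integral_nonneg_of_ae_restrict hab ?_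
    rw [EventuallyLE, ← restrict_Ioo_eq_restrict_Icc, ae_restrict_iff' measurableSet_Ioo]
    filter_upwards [h, hy.ae_differentiableAt] with x hx hd hxm
    have hd := (hd (by rw [uIcc_of_le hab]; exact Ioo_subset_Icc_self hxm)).hasDerivAt
    have hx := hx hxm
    have he' : HasDerivAt (fun x => Real.exp (-K * x)) (Real.exp (-K * x) * (-K)) x := by
      simpa using ((hasDerivAt_id x).const_mul (-K)).exp
    rw [(he'.fun_mul hd).deriv]
    have := mul_nonneg (Real.exp_pos (-K * x)).le (sub_nonneg.2 hx)
    simp only [Pi.zero_apply]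
    linarith
  rw [intervalIntegral.integral_neg, hint] at hle
  have h1 : Real.exp (-K * a) * y a ≤ 0 := mul_nonpos_of_nonneg_of_nonpos (Real.exp_pos _).le ha
  have h2 : Real.exp (-K * b) * y b ≤ 0 := by linarith
  by_contra! hc
  exact absurd h2 (not_le.2 (mul_pos (Real.exp_pos _) hc))

/-! ### The energy argument in an inner product space -/

section Abstract

variable {H : Type*} [NormedAddCommGroup H] [InnerProductSpace ℝ H]

open scoped RealInnerProductSpace

/-- The derivative of the quadratic form of a nonnegative symmetric operator along a curve `w`,
where `b r` is the value of the operator at `w r`. -/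
theorem HasDerivAt.of_symm_nonneg {b w : ℝ → H} {w' : H} {t φ' : ℝ}
    (hsymm : ∀ᶠ r in 𝓝 t, ⟪b r, w t⟫ = ⟪b t, w r⟫)
    (hpos : ∀ᶠ r in 𝓝 t, 0 ≤ ⟪b r - b t, w r - w t⟫)
    (hw : HasDerivAt w w' t) (hφ : HasDerivAt (fun r => ⟪b r, w r⟫) φ' t) :
    φ' = 2 * ⟪b t, w'⟫ := by
  have h1 : HasDerivAt (fun r => 2 * ⟪b t, w r⟫) (2 * ⟪b t, w'⟫) t := by
    have := ((hasDerivAt_const t (b t)).inner ℝ hw).const_mul (2 : ℝ)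
    simpa using this
  -- By symmetry, `⟪b r - b t, w r - w t⟫` is this function at `r` minus its value at `t`.
  -- Differentiability of `b` is therefore never needed.
  have hmin : IsLocalMin (fun r => ⟪b r, w r⟫ - 2 * ⟪b t, w r⟫) t := by
    filter_upwards [hsymm, hpos] with r hs hp
    simp only [inner_sub_left, inner_sub_right] at hp
    linarith
  have := hmin.hasDerivAt_eq_zero (hφ.sub h1)
  linarith

/-- A Lipschitz curve `w` with `w a = 0`, satisfying the differential inequality obtained by
testing `A w' + b ∋ g` with `w'`, where `b` is the value of a symmetric nonnegative operator at `w`,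
`A` is strongly monotone and `g` is bounded by a multiple of `w`, vanishes. -/
theorem eq_zero_of_energy_inequality {b w w' : ℝ → H} {a T M C σ L : ℝ} (haT : a ≤ T) (hσ : 0 < σ)
    (hsymm : ∀ t ∈ Icc a T, ∀ r ∈ Icc a T, ⟪b r, w t⟫ = ⟪b t, w r⟫)
    (hpos' : ∀ t ∈ Icc a T, 0 ≤ ⟪b t, w t⟫)
    (hpos : ∀ t ∈ Icc a T, ∀ r ∈ Icc a T, 0 ≤ ⟪b r - b t, w r - w t⟫)
    (hb : ∀ t ∈ Icc a T, ‖b t‖ ≤ M)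
    (hlip : ∀ t ∈ Icc a T, ∀ r ∈ Icc a T, ‖w t - w r‖ ≤ C * |t - r|)
    (hderiv : ∀ᵐ t, t ∈ Ioo a T → HasDerivAt w (w' t) t)
    (hineq : ∀ᵐ t, t ∈ Ioo a T → ⟪b t, w' t⟫ ≤ -σ * ‖w' t‖ ^ 2 + L * ‖w t‖ * ‖w' t‖)
    (ha : w a = 0) : w T = 0 := by
  have hM : 0 ≤ M := (norm_nonneg _).trans (hb a ⟨le_rfl, haT⟩)
  have hwb : ∀ t ∈ Icc a T, ‖w t‖ ≤ |C| * (T - a) := by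
    intro t ht
    have h := hlip t ht a ⟨le_rfl, haT⟩
    rw [ha, sub_zero, abs_of_nonneg (sub_nonneg.2 ht.1)] at h
    calc ‖w t‖ ≤ C * (t - a) := h
      _ ≤ |C| * (t - a) := mul_le_mul_of_nonneg_right (le_abs_self C) (sub_nonneg.2 ht.1)
      _ ≤ |C| * (T - a) := mul_le_mul_of_nonneg_left (by linarith [ht.2]) (abs_nonneg C)
  have hφac : AbsolutelyContinuousOnInterval (fun r => ⟪b r, w r⟫) a T := by
    refine LipschitzOnWith.absolutelyContinuousOnInterval (K := (2 * M * |C|).toNNReal) ?_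
    rw [uIcc_of_le haT]
    refine LipschitzOnWith.of_dist_le_mul fun t ht r hr => ?_
    rw [Real.coe_toNNReal _ (by positivity), Real.dist_eq, Real.dist_eq]
    -- Symmetry cancels the cross terms, so only `w` has to be Lipschitz; `b` only has to be
    -- bounded.
    have : ⟪b t, w t⟫ - ⟪b r, w r⟫ = ⟪b t + b r, w t - w r⟫ := by
      simp only [inner_sub_right, inner_add_left]
      linarith [hsymm t ht r hr]
    rw [this]
    calc _ ≤ ‖b t + b r‖ * ‖w t - w r‖ := abs_real_inner_le_norm _ _
      _ ≤ (2 * M) * (|C| * |t - r|) := by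
        gcongr
        · linarith [norm_add_le (b t) (b r), hb t ht, hb r hr]
        · exact (hlip t ht r hr).trans
            (mul_le_mul_of_nonneg_right (le_abs_self C) (abs_nonneg _))
      _ = _ := by ring
  have hnac : AbsolutelyContinuousOnInterval (fun r => ⟪w r, w r⟫) a T := by
    have hT : 0 ≤ T - a := sub_nonneg.2 haT
    refine LipschitzOnWith.absolutelyContinuousOnInterval
      (K := (2 * (|C| * (T - a)) * |C|).toNNReal) ?_
    rw [uIcc_of_le haT]
    refine LipschitzOnWith.of_dist_le_mul fun t ht r hr => ?_
    rw [Real.coe_toNNReal _ (by positivity), Real.dist_eq, Real.dist_eq]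
    have : ⟪w t, w t⟫ - ⟪w r, w r⟫ = ⟪w t + w r, w t - w r⟫ := by
      simp only [inner_sub_right, inner_add_left]
      linarith [real_inner_comm (w t) (w r)]
    rw [this]
    calc _ ≤ ‖w t + w r‖ * ‖w t - w r‖ := abs_real_inner_le_norm _ _
      _ ≤ (2 * (|C| * (T - a))) * (|C| * |t - r|) := by
        gcongr
        · linarith [norm_add_le (w t) (w r), hwb t ht, hwb r hr]
        · exact (hlip t ht r hr).trans
            (mul_le_mul_of_nonneg_right (le_abs_self C) (abs_nonneg _))
      _ = _ := by ring
  have hmain := (hφac.fun_add hnac).nonpos_of_ae_deriv_le (K := (L + 1) ^ 2 / (2 * σ)) haT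
    (by simp [ha]) ?_
  · have h1 := hpos' T ⟨haT, le_rfl⟩
    rw [real_inner_self_eq_norm_sq] at hmain
    have : ‖w T‖ ^ 2 = 0 := le_antisymm (by linarith) (sq_nonneg _)
    simpa using this
  · filter_upwards [hφac.ae_differentiableAt, hderiv, hineq] with t hd hw hi ht
    have htc := Ioo_subset_Icc_self ht
    have hd := (hd (by rwa [uIcc_of_le haT])).hasDerivAt
    have hw := hw ht
    have hi := hi ht
    have hnear : ∀ᶠ r in 𝓝 t, r ∈ Icc a T := Icc_mem_nhds ht.1 ht.2
    have hφ' := HasDerivAt.of_symm_nonneg (hnear.mono fun r hr => hsymm t htc r hr)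
      (hnear.mono fun r hr => hpos t htc r hr) hw hd
    rw [(hd.fun_add (hw.inner ℝ hw)).deriv, hφ', real_inner_comm (w t) (w' t)]
    have hcs := real_inner_le_norm (w t) (w' t)
    have hφ0 := hpos' t htc
    rw [real_inner_self_eq_norm_sq]
    have hK : 0 ≤ (L + 1) ^ 2 / (2 * σ) * ⟪b t, w t⟫ := by positivity
    -- Completing the square absorbs `‖w'‖`; the `+ 1` comes from the derivative of `‖w‖²`.
    have hsq : 2 * (-σ * ‖w' t‖ ^ 2 + (L + 1) * ‖w t‖ * ‖w' t‖)
        ≤ (L + 1) ^ 2 / (2 * σ) * ‖w t‖ ^ 2 := by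
      rw [div_mul_eq_mul_div, le_div_iff₀ (by positivity)]
      nlinarith [sq_nonneg ((L + 1) * ‖w t‖ - 2 * σ * ‖w' t‖)]
    linarith

end Abstract

namespace DoublyNonlinear

open scoped RealInnerProductSpace

/-! ### Pointwise estimates for `α` and `W'` -/

theorem HypAlpha.mul_sq_le {α : ℝ → ℝ} {σ : ℝ} (hα : HypAlpha α σ) (x y : ℝ) :
    σ * (x - y) ^ 2 ≤ (α x - α y) * (x - y) := by
  have h := mul_sub_le_image_sub_of_le_deriv (hα.contDiff.differentiable (by simp)) hα.le_deriv
  rcases le_total x y with hxy | hxy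
  · nlinarith [h hxy]
  · nlinarith [h hxy]

/-- `W'` is Lipschitz on each of its sublevel sets `{|W'| ≤ R}`. -/
theorem HypW.exists_lipschitz {I : Set ℝ} {W : ℝ → ℝ} {lam : ℝ} (hW : HypW I W lam) (R : ℝ) :
    ∃ L : ℝ≥0, ∀ x ∈ I, ∀ y ∈ I, |deriv W x| ≤ R → |deriv W y| ≤ R →
      |deriv W x - deriv W y| ≤ L * |x - y| := by
  -- The level `R + 1` strictly exceeds `R`, so the sublevel set must lie in `K`; a locally
  -- Lipschitz function is Lipschitz on a compact set.
  obtain ⟨K, hKI, hK, hout⟩ := hW.coercive (R + 1)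
  obtain ⟨L, hL⟩ := (hW.locallyLipschitzOn.mono hKI).exists_lipschitzOnWith_of_compact hK
  have hmem : ∀ x ∈ I, |deriv W x| ≤ R → x ∈ K := by
    intro x hx hxR
    by_contra hxK
    have h1 := hout x ⟨hx, hxK⟩
    have h2 : |deriv W x * Real.sign x| ≤ |deriv W x| := by
      rw [abs_mul]
      refine mul_le_of_le_one_right (abs_nonneg _) ?_
      rcases Real.sign_apply_eq x with h | h | h <;> simp [h]
    linarith [le_abs_self (deriv W x * Real.sign x)]
  refine ⟨L, fun x hx y hy hxR hyR => ?_⟩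
  simpa [Real.dist_eq] using hL.dist_le_mul x (hmem x hx hxR) y (hmem y hy hyR)

/-! ### Linearity, symmetry and nonnegativity of `B` -/

variable {N : ℕ} {Ω : Set (EuclideanSpace ℝ (Fin N))} {bc : BoundaryCondition}

theorem B_apply (p q : V bc Ω) :
    B bc Ω p q = bc.massCoeff * ⟪p.1.fst, q.1.fst⟫ + ⟪p.1.snd, q.1.snd⟫ := by
  simp [B]

theorem BoundaryCondition.massCoeff_nonneg (bc : BoundaryCondition) : 0 ≤ bc.massCoeff := by
  cases bc <;> simp [massCoeff]

/-- Working with the relation `IsB` gives linearity for whichever representatives `BH` chooses, so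
their uniqueness is not needed. -/
theorem IsB.sub {u₁ u₂ h₁ h₂ : L2 Ω} (H₁ : IsB bc Ω u₁ h₁) (H₂ : IsB bc Ω u₂ h₂) :
    IsB bc Ω (u₁ - u₂) (h₁ - h₂) := by
  obtain ⟨p, hp, hpq⟩ := H₁
  obtain ⟨q, hq, hqq⟩ := H₂
  refine ⟨p - q, by simp [hp, hq], fun r => ?_⟩
  rw [map_sub, inner_sub_left, ← hpq, ← hqq]
  rfl

theorem IsB.inner_symm {u₁ u₂ h₁ h₂ : L2 Ω} (H₁ : IsB bc Ω u₁ h₁) (H₂ : IsB bc Ω u₂ h₂) :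
    ⟪h₁, u₂⟫ = ⟪h₂, u₁⟫ := by
  obtain ⟨p, rfl, hpq⟩ := H₁
  obtain ⟨q, rfl, hqq⟩ := H₂
  rw [← hpq, ← hqq, B_apply, B_apply, real_inner_comm p.1.fst, real_inner_comm p.1.snd]

theorem IsB.inner_nonneg {u h : L2 Ω} (H : IsB bc Ω u h) : 0 ≤ ⟪h, u⟫ := by
  obtain ⟨p, rfl, hp⟩ := H
  rw [← hp, B_apply]
  exact add_nonneg (mul_nonneg bc.massCoeff_nonneg real_inner_self_nonneg) real_inner_self_nonneg

variable {α : ℝ → ℝ} {σ : ℝ} {I : Set ℝ} {W : ℝ → ℝ} {lam : ℝ}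

theorem MemX2.isB_BH {u : L2 Ω} (hu : MemX2 bc Ω I W u) : IsB bc Ω u (BH bc Ω u) := by
  rw [BH, dif_pos hu.exists_B]
  exact hu.exists_B.choose_spec

/-! ### Superposition operators and bounds from the metrics -/

theorem superpos_coeFn {g : ℝ → ℝ} {u : L2 Ω}
    (h : MemLp (fun x => g (u x)) 2 (volume.restrict Ω)) :
    superpos Ω g u =ᵐ[volume.restrict Ω] fun x => g (u x) := by
  rw [superpos, dif_pos h]
  exact h.coeFn_toLp

theorem superpos_zero {g : ℝ → ℝ} (hg : g 0 = 0) : superpos Ω g 0 = 0 := by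
  have h0 : (fun x => g ((0 : L2 Ω) x)) =ᵐ[volume.restrict Ω] (0 : L2 Ω) := by
    filter_upwards [Lp.coeFn_zero ℝ 2 (volume.restrict Ω)] with x hx
    rw [hx, Pi.zero_apply, hg]
  refine Lp.ext ((superpos_coeFn ?_).trans h0)
  exact (memLp_congr_ae h0).2 (Lp.memLp _)

theorem ae_abs_le_normInf {u : L2 Ω} (hu : MemLp u ∞ (volume.restrict Ω)) :
    ∀ᵐ x ∂(volume.restrict Ω), |u x| ≤ normInf Ω u := by
  filter_upwards [ae_le_eLpNormEssSup (f := u) (μ := volume.restrict Ω)] with x hx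
  rw [← Real.norm_eq_abs, normInf, eLpNorm_exponent_top, ← toReal_enorm]
  exact ENNReal.toReal_mono (by simpa using hu.eLpNorm_ne_top) hx

/-- Elements of a bounded subset of `X_∞` have uniformly bounded `W'(u)`. -/
theorem MemXInf.ae_abs_deriv_le {u : L2 Ω} {c : ℝ} (hu : MemXInf bc Ω I W u)
    (hW : HypW I W lam) (hc : dInf bc Ω W lam u 0 ≤ c) :
    ∀ᵐ x ∂(volume.restrict Ω), |deriv W (u x)| ≤ c + lam * c := by
  have hc0 : 0 ≤ c := (Real.sqrt_nonneg _).trans hc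
  have hsum := (Real.sqrt_le_left hc0).1 hc
  have hz : WlamH Ω W lam (0 : L2 Ω) = 0 := by
    rw [WlamH, superpos_zero hW.deriv_zero, smul_zero, add_zero]
  rw [hz, sub_zero, sub_zero] at hsum
  have hu2 := sq_nonneg (normInf Ω u)
  have hB2 := sq_nonneg (normInf Ω (BH bc Ω u - BH bc Ω 0))
  have hW2 := sq_nonneg (normInf Ω (WlamH Ω W lam u))
  -- The metric controls `u` and `W'(u) + lam u`; subtracting `lam u` leaves the bound `c + lam * c`
  -- for `W'(u)`.
  have h1 : normInf Ω u ≤ c := (abs_le_of_sq_le_sq' (by linarith) hc0).2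
  have h2 : normInf Ω (WlamH Ω W lam u) ≤ c := (abs_le_of_sq_le_sq' (by linarith) hc0).2
  have hadd : WlamH Ω W lam u =ᵐ[volume.restrict Ω]
      ⇑(superpos Ω (deriv W) u) + lam • ⇑u :=
    (Lp.coeFn_add _ _).trans (EventuallyEq.rfl.add (Lp.coeFn_smul lam u))
  have hmem : MemLp (WlamH Ω W lam u) ∞ (volume.restrict Ω) :=
    (memLp_congr_ae hadd).2 (hu.memLp_W.add (hu.memLp_u.const_smul lam))
  filter_upwards [hadd, ae_abs_le_normInf hu.memLp_u, ae_abs_le_normInf hmem,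
    superpos_coeFn hu.memX2.memLp_W] with x hx hux hwx hsx
  rw [Pi.add_apply, Pi.smul_apply, smul_eq_mul, hsx] at hx
  have hlu : |lam * u x| ≤ lam * c := by
    rw [abs_mul, abs_of_nonneg hW.lam_nonneg]
    exact mul_le_mul_of_nonneg_left (hux.trans h1) hW.lam_nonneg
  calc |deriv W (u x)| = |WlamH Ω W lam u x - lam * u x| := by rw [hx]; ring_nf
    _ ≤ |WlamH Ω W lam u x| + |lam * u x| := abs_sub _ _
    _ ≤ c + lam * c := add_le_add (hwx.trans h2) hlu

theorem norm_superpos_sub_le {g : ℝ → ℝ} {u v : L2 Ω} {L : ℝ}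
    (hu : MemLp (fun x => g (u x)) 2 (volume.restrict Ω))
    (hv : MemLp (fun x => g (v x)) 2 (volume.restrict Ω))
    (h : ∀ᵐ x ∂(volume.restrict Ω), |g (u x) - g (v x)| ≤ L * |u x - v x|) :
    ‖superpos Ω g u - superpos Ω g v‖ ≤ L * ‖u - v‖ := by
  refine Lp.norm_le_mul_norm_of_ae_le_mul ?_
  filter_upwards [h, superpos_coeFn hu, superpos_coeFn hv, Lp.coeFn_sub u v,
    Lp.coeFn_sub (superpos Ω g u) (superpos Ω g v)] with x hx h1 h2 h3 h4
  rw [h3, h4, Pi.sub_apply, Pi.sub_apply, h1, h2]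
  exact hx

theorem HypAlpha.mul_norm_sq_le {u v : L2 Ω} (hα : HypAlpha α σ)
    (hu : MemLp (fun x => α (u x)) 2 (volume.restrict Ω))
    (hv : MemLp (fun x => α (v x)) 2 (volume.restrict Ω)) :
    σ * ‖u - v‖ ^ 2 ≤ ⟪superpos Ω α u - superpos Ω α v, u - v⟫ := by
  rw [← real_inner_self_eq_norm_sq, ← real_inner_smul_left, ← sub_nonneg, ← inner_sub_left,
    L2.inner_def]
  refine integral_nonneg_of_ae ?_
  filter_upwards [superpos_coeFn hu, superpos_coeFn hv, Lp.coeFn_sub u v,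
    Lp.coeFn_sub (superpos Ω α u) (superpos Ω α v), Lp.coeFn_smul σ (u - v),
    Lp.coeFn_sub (superpos Ω α u - superpos Ω α v) (σ • (u - v))] with x h1 h2 h3 h4 h5 h6
  rw [h6, Pi.sub_apply, h5, Pi.smul_apply, h4, Pi.sub_apply, h3, Pi.sub_apply, h1, h2]
  simp only [smul_eq_mul, RCLike.inner_apply, conj_trivial, Pi.zero_apply]
  nlinarith [hα.mul_sq_le (u x) (v x)]

/-- Along a solution this bounds `Bu` at every time, not merely almost every time, as the Lipschitz
estimate for `(Bw, w)` requires. The value `BH bc Ω 0` is kept as a constant rather than computed.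
-/
theorem norm_BH_le {u : L2 Ω} {C : ℝ} (hC : 0 < C) (h : d2 bc Ω W lam u 0 ^ 2 ≤ C ^ 2) :
    ‖BH bc Ω u‖ ≤ C + ‖BH bc Ω 0‖ := by
  rw [d2, Real.sq_sqrt (by positivity)] at h
  have hu2 := sq_nonneg ‖u - 0‖
  have hW2 := sq_nonneg ‖WlamH Ω W lam u - WlamH Ω W lam 0‖
  have h1 : ‖BH bc Ω u - BH bc Ω 0‖ ≤ C := (abs_le_of_sq_le_sq' (by linarith) hC.le).2
  linarith [norm_le_norm_add_norm_sub' (BH bc Ω u) (BH bc Ω 0)]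

/-! ### Essentially bounded curves in time -/

theorem MemLInfTime.exists_bound {z : ℝ → L2 Ω} (hz : MemLInfTime z) :
    ∃ C : ℝ, ∀ᵐ t, 0 < t → ‖z t‖ ≤ C := by
  refine ⟨(eLpNormEssSup z (volume.restrict (Ioi 0))).toReal, ?_⟩
  refine (ae_restrict_iff' (s := Ioi (0 : ℝ)) measurableSet_Ioi).1 ?_
  filter_upwards [ae_le_eLpNormEssSup (f := z) (μ := volume.restrict (Ioi 0))] with t ht
  rw [← toReal_enorm]
  exact ENNReal.toReal_mono (by simpa using hz.eLpNorm_ne_top) ht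

theorem MemLInfTime.intervalIntegrable {z : ℝ → L2 Ω} (hz : MemLInfTime z) {a b : ℝ}
    (ha : 0 ≤ a) (hb : 0 ≤ b) : IntervalIntegrable z volume a b := by
  rw [intervalIntegrable_iff]
  have hsub : uIoc a b ⊆ Ioi 0 := fun x hx => (le_min ha hb).trans_lt hx.1
  have : IsFiniteMeasure (volume.restrict (uIoc a b)) :=
    ⟨by simp [uIoc, Real.volume_Ioc]⟩
  exact (MemLp.mono_measure (Measure.restrict_mono hsub le_rfl) hz).integrable le_top

end DoublyNonlinear

/-! ### Uniqueness -/

theorem mainTheorem6 {N : ℕ} (hN1 : 1 ≤ N) (hN3 : N ≤ 3)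
    (bc : DoublyNonlinear.BoundaryCondition)
    (Ω : Set (EuclideanSpace ℝ (Fin N))) (hΩ : DoublyNonlinear.IsSmoothBoundedDomain Ω)
    (α : ℝ → ℝ) (σ : ℝ) (hα : DoublyNonlinear.HypAlpha α σ)
    (I : Set ℝ) (W : ℝ → ℝ) (lam : ℝ) (hW : DoublyNonlinear.HypW I W lam)
    (f : EuclideanSpace ℝ (Fin N) → ℝ) (hf : MemLp f ∞ (volume.restrict Ω))
    (u₀ v₀ : DoublyNonlinear.L2 Ω)
    (hu₀ : DoublyNonlinear.MemX2 bc Ω I W u₀) (hv₀ : DoublyNonlinear.MemX2 bc Ω I W v₀)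
    (u v : ℝ → DoublyNonlinear.L2 Ω)
    (hu : DoublyNonlinear.IsX2Solution bc Ω α I W lam f u₀ u)
    (hv : DoublyNonlinear.IsX2Solution bc Ω α I W lam f v₀ v)
    (s c : ℝ) (hs : 0 ≤ s) (hc : 0 ≤ c)
    (huv : u s = v s)
    (huInf : ∀ t, s ≤ t → DoublyNonlinear.MemXInf bc Ω I W (u t))
    (hvInf : ∀ t, s ≤ t → DoublyNonlinear.MemXInf bc Ω I W (v t))
    (hbound : ∀ t, s ≤ t →
      DoublyNonlinear.dInf bc Ω W lam (u t) 0 + DoublyNonlinear.dInf bc Ω W lam (v t) 0 ≤ c) :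
    ∀ t, s ≤ t → u t = v t := by
  open DoublyNonlinear RealInnerProductSpace in
  intro T hT
  obtain ⟨Cu, hCu, hdu⟩ := hu.d2_bound
  obtain ⟨Cv, hCv, hdv⟩ := hv.d2_bound
  obtain ⟨ut, hut, hui, huα, -, hueq⟩ := hu.exists_ut
  obtain ⟨vt, hvt, hvi, hvα, -, hveq⟩ := hv.exists_ut
  obtain ⟨L, hL⟩ := hW.exists_lipschitz (c + lam * c)
  have hwt : MemLInfTime (fun t => ut t - vt t) := MemLp.sub hut hvt
  obtain ⟨C, hC⟩ := hwt.exists_bound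
  have hdiff : ∀ t r, 0 ≤ t → 0 ≤ r →
      (u t - v t) - (u r - v r) = ∫ τ in r..t, (ut τ - vt τ) := by
    intro t r ht hr
    rw [intervalIntegral.integral_sub (hut.intervalIntegrable hr ht)
      (hvt.intervalIntegrable hr ht), hui t ht, hui r hr, hvi t ht, hvi r hr,
      ← intervalIntegral.integral_interval_sub_left (hut.intervalIntegrable le_rfl ht)
        (hut.intervalIntegrable le_rfl hr),
      ← intervalIntegral.integral_interval_sub_left (hvt.intervalIntegrable le_rfl ht)
        (hvt.intervalIntegrable le_rfl hr)]
    abel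
  have hB : ∀ t ∈ Icc s T, IsB bc Ω (u t - v t) (BH bc Ω (u t) - BH bc Ω (v t)) := fun t ht =>
    (hu.memX2 t (hs.trans ht.1)).isB_BH.sub (hv.memX2 t (hs.trans ht.1)).isB_BH
  have hzero : u T - v T = 0 := by
    refine eq_zero_of_energy_inequality (w := fun t => u t - v t)
      (b := fun t => BH bc Ω (u t) - BH bc Ω (v t)) (w' := fun t => ut t - vt t)
      (M := (Cu + ‖BH bc Ω (0 : L2 Ω)‖) + (Cv + ‖BH bc Ω (0 : L2 Ω)‖)) (C := C) (L := L)
      hT hα.sigma_pos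
      (fun t ht r hr => (hB r hr).inner_symm (hB t ht))
      (fun t ht => (hB t ht).inner_nonneg)
      (fun t ht r hr => ((hB r hr).sub (hB t ht)).inner_nonneg)
      (fun t ht => (norm_sub_le _ _).trans (add_le_add
        (norm_BH_le hCu (hdu t (hs.trans ht.1))) (norm_BH_le hCv (hdv t (hs.trans ht.1)))))
      ?_ ?_ ?_ (sub_eq_zero.2 huv)
    · intro t ht r hr
      rw [hdiff t r (hs.trans ht.1) (hs.trans hr.1)]
      refine intervalIntegral.norm_integral_le_of_norm_le_const_ae ?_
      filter_upwards [hC] with τ hτ hm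
      exact hτ ((le_min (hs.trans hr.1) (hs.trans ht.1)).trans_lt hm.1)
    -- Lebesgue differentiation: near `t`, `u - v` is the integral of `ut - vt` from `s`, because it
    -- vanishes at `s`.
    · filter_upwards [(hwt.intervalIntegrable hs (hs.trans hT)).ae_hasDerivAt_integral] with t h ht
      have h := h (by rw [uIcc_of_le hT]; exact Ioo_subset_Icc_self ht) s left_mem_uIcc
      refine h.congr_of_eventuallyEq ?_
      filter_upwards [Ioo_mem_nhds ht.1 ht.2] with r hr
      rw [← hdiff r s (hs.trans hr.1.le) hs, huv, sub_self, sub_zero]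
    · rw [ae_restrict_iff' measurableSet_Ioi] at huα hvα hueq hveq
      filter_upwards [huα, hvα, hueq, hveq] with t huα hvα hueq hveq ht
      have ht0 : t ∈ Ioi (0 : ℝ) := hs.trans_lt ht.1
      have hXu := huInf t ht.1.le
      have hXv := hvInf t ht.1.le
      have hb := hbound t ht.1.le
      have hmono := hα.mul_norm_sq_le (huα ht0) (hvα ht0)
      have hlip : ‖superpos Ω (deriv W) (u t) - superpos Ω (deriv W) (v t)‖
          ≤ L * ‖u t - v t‖ := by
        refine norm_superpos_sub_le hXu.memX2.memLp_W hXv.memX2.memLp_W ?_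
        have h1 : 0 ≤ dInf bc Ω W lam (u t) 0 := Real.sqrt_nonneg _
        have h2 : 0 ≤ dInf bc Ω W lam (v t) 0 := Real.sqrt_nonneg _
        filter_upwards [hXu.memX2.mem_I, hXv.memX2.mem_I,
          hXu.ae_abs_deriv_le hW (c := c) (by linarith), hXv.ae_abs_deriv_le hW (c := c) (by linarith)]
          with x hx hy hx' hy' using hL _ hx _ hy hx' hy'
      -- Both left-hand sides agree a.e. with the same `f`, which drops out.
      have heq := Lp.ext ((hueq ht0).trans (hveq ht0).symm)
      have hBeq : BH bc Ω (u t) - BH bc Ω (v t)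
          = -(superpos Ω α (ut t) - superpos Ω α (vt t))
            - (superpos Ω (deriv W) (u t) - superpos Ω (deriv W) (v t)) := by
        rw [← sub_eq_zero] at heq ⊢
        rw [← heq]
        abel
      have hcs := (abs_le.1 (abs_real_inner_le_norm
        (superpos Ω (deriv W) (u t) - superpos Ω (deriv W) (v t)) (ut t - vt t))).1
      have hcs' := mul_le_mul_of_nonneg_right hlip (norm_nonneg (ut t - vt t))
      change ⟪BH bc Ω (u t) - BH bc Ω (v t), ut t - vt t⟫
        ≤ -σ * ‖ut t - vt t‖ ^ 2 + L * ‖u t - v t‖ * ‖ut t - vt t‖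
      rw [hBeq, inner_sub_left, inner_neg_left]
      linarith
  exact sub_eq_zero.1 hzero
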